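/- Let formulas of intuitionistic propositional logic be built from propositional variables and $\bot$ with the connectives $\wedge,\vee,\to$, and let $\vdash$ denote intuitionistic entailment between formulas. For a set $S$ of propositional variables, call a formula $S$-free if no variable of $S$ occurs in it. Theorem (Pitts). For every formula $\varphi$ and every set $S$ of propositional variables, there exist formulas $\mathsf{E}_S(\varphi)$ and $\mathsf{A}_S(\varphi)$, called a right and a left (deductive) uniform interpolant for $\varphi$ with respect to $S$, such that: (Right) $\mathsf{E}_S(\varphi)$ is $S$-free and contains only variables that occur in $\varphi$; $\varphi \vdash \mathsf{E}_S(\varphi)$; and for every $S$-free formula $\theta$, if $\varphi \vdash \theta$ then $\mathsf{E}_S(\varphi) \vdash \theta$. (Left) $\mathsf{A}_S(\varphi)$ is $S$-free and contains only variables that occur in $\varphi$; $\mathsf{A}_S(\varphi) \vdash \varphi$; and for every $S$-free formula $\psi$, if $\psi \vdash \varphi$ then $\psi \vdash \mathsf{A}_S(\varphi)$. -/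

import Mathlib

namespace IPC

/-- Formulas of intuitionistic propositional logic over a type `V` of propositional variables,
with primitive connectives falsum, conjunction, disjunction and implication. -/
inductive Formula (V : Type*) where
  | var (p : V) : Formula V
  | bot : Formula V
  | and (φ ψ : Formula V) : Formula V
  | or (φ ψ : Formula V) : Formula V
  | imp (φ ψ : Formula V) : Formula V

/-- The set of propositional variables that occur in a formula. -/
def Formula.vars {V : Type*} : Formula V → Set V
  | .var p => {p}
  | .bot => ∅
  | .and φ ψ => φ.vars ∪ ψ.vars
  | .or φ ψ => φ.vars ∪ ψ.vars
  | .imp φ ψ => φ.vars ∪ ψ.vars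

/-- Intuitionistic derivability of a formula from a set of assumptions, in natural deduction. -/
inductive Derives {V : Type*} : Set (Formula V) → Formula V → Prop where
  | ax {Γ : Set (Formula V)} {φ : Formula V} (h : φ ∈ Γ) : Derives Γ φ
  | botE {Γ : Set (Formula V)} {φ : Formula V} (h : Derives Γ .bot) : Derives Γ φ
  | andI {Γ : Set (Formula V)} {φ ψ : Formula V} (h₁ : Derives Γ φ) (h₂ : Derives Γ ψ) :
      Derives Γ (.and φ ψ)
  | andE₁ {Γ : Set (Formula V)} {φ ψ : Formula V} (h : Derives Γ (.and φ ψ)) : Derives Γ φ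
  | andE₂ {Γ : Set (Formula V)} {φ ψ : Formula V} (h : Derives Γ (.and φ ψ)) : Derives Γ ψ
  | orI₁ {Γ : Set (Formula V)} {φ ψ : Formula V} (h : Derives Γ φ) : Derives Γ (.or φ ψ)
  | orI₂ {Γ : Set (Formula V)} {φ ψ : Formula V} (h : Derives Γ ψ) : Derives Γ (.or φ ψ)
  | orE {Γ : Set (Formula V)} {φ ψ χ : Formula V} (h : Derives Γ (.or φ ψ))
      (h₁ : Derives (insert φ Γ) χ) (h₂ : Derives (insert ψ Γ) χ) : Derives Γ χ
  | impI {Γ : Set (Formula V)} {φ ψ : Formula V} (h : Derives (insert φ Γ) ψ) :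
      Derives Γ (.imp φ ψ)
  | impE {Γ : Set (Formula V)} {φ ψ : Formula V} (h₁ : Derives Γ (.imp φ ψ))
      (h₂ : Derives Γ φ) : Derives Γ ψ

/-- The intuitionistic entailment relation between formulas. -/
def Entails {V : Type*} (φ ψ : Formula V) : Prop := Derives {φ} ψ

/-- `φ` is `S`-free: no variable from `S` occurs in `φ`. -/
def FreeOf {V : Type*} (S : Set V) (φ : Formula V) : Prop := ∀ p ∈ φ.vars, p ∉ S

/-- `ε` is a right uniform interpolant for `φ` with respect to the set `S` of eliminated
variables. -/
structure IsRightUniformInterpolant {V : Type*} (S : Set V) (φ ε : Formula V) : Prop where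
  vars_subset : ε.vars ⊆ φ.vars
  freeOf : FreeOf S ε
  entails : Entails φ ε
  least : ∀ θ : Formula V, FreeOf S θ → Entails φ θ → Entails ε θ

/-- `α` is a left uniform interpolant for `φ` with respect to the set `S` of eliminated
variables. -/
structure IsLeftUniformInterpolant {V : Type*} (S : Set V) (φ α : Formula V) : Prop where
  vars_subset : α.vars ⊆ φ.vars
  freeOf : FreeOf S α
  entails : Entails α φ
  greatest : ∀ ψ : Formula V, FreeOf S ψ → Entails ψ φ → Entails ψ α

end IPC

/-! Work in the canonical model, whose worlds are prime theories. Over the finite set `Q` of kept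
variables, the finite sets `layer Q n` measure bounded bisimilarity of theories. The crux is
`exists_amalgam`: if `k` and `m` agree on `layer Q (rounds φ)`, some world of a Kripke model forces
the same `S`-free formulas as `k`, and forces `φ` iff `φ ∈ m`.

So finitely many candidates suffice. The right interpolant is the conjunction of the consequences of
`φ` in the layer after `rounds φ`; the left one is the disjunction of those conjunctions over that
layer that entail `φ`. A theory `k` violating optimality yields, by `typeRefuter_mem` or
`exists_agree_of_subset`, a partner `m` whose amalgam with `k` (or with an extension of `k`)
contradicts soundness. -/

namespace IPC

open scoped Classical

variable {V : Type*}

/-! ### Natural deduction: weakening, cut, compactness along chains -/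

namespace Derives

theorem weaken {Γ Δ : Set (Formula V)} {φ : Formula V} (h : Derives Γ φ) (hΓ : Γ ⊆ Δ) :
    Derives Δ φ := by
  induction h generalizing Δ with
  | ax h => exact .ax (hΓ h)
  | botE _ ih => exact .botE (ih hΓ)
  | andI _ _ ih₁ ih₂ => exact .andI (ih₁ hΓ) (ih₂ hΓ)
  | andE₁ _ ih => exact .andE₁ (ih hΓ)
  | andE₂ _ ih => exact .andE₂ (ih hΓ)
  | orI₁ _ ih => exact .orI₁ (ih hΓ)
  | orI₂ _ ih => exact .orI₂ (ih hΓ)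
  | orE _ _ _ ih ih₁ ih₂ =>
    exact .orE (ih hΓ) (ih₁ (Set.insert_subset_insert hΓ)) (ih₂ (Set.insert_subset_insert hΓ))
  | impI _ ih => exact .impI (ih (Set.insert_subset_insert hΓ))
  | impE _ _ ih₁ ih₂ => exact .impE (ih₁ hΓ) (ih₂ hΓ)

theorem cut {Γ : Set (Formula V)} {φ ψ : Formula V} (h₁ : Derives Γ φ)
    (h₂ : Derives (insert φ Γ) ψ) : Derives Γ ψ :=
  .impE (.impI h₂) h₁

/-- A derivation from the union of a nonempty chain uses only assumptions from one member. -/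
theorem of_sUnion_chain {c : Set (Set (Formula V))} (hc : IsChain (· ⊆ ·) c) (hne : c.Nonempty)
    {Γ : Set (Formula V)} {φ : Formula V} (h : Derives Γ φ) :
    ∀ Δ : Set (Formula V), Γ ⊆ Δ ∪ ⋃₀ c → ∃ T ∈ c, Derives (Δ ∪ T) φ := by
  have join : ∀ {T U}, T ∈ c → U ∈ c → ∃ W ∈ c, T ⊆ W ∧ U ⊆ W := by
    intro T U hT hU
    rcases hc.total hT hU with h | h
    · exact ⟨U, hU, h, subset_rfl⟩
    · exact ⟨T, hT, subset_rfl, h⟩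
  have up : ∀ {T U Δ : Set (Formula V)}, T ⊆ U → Δ ∪ T ⊆ Δ ∪ U :=
    fun h => Set.union_subset_union_right _ h
  -- Discharged hypotheses are absorbed by `Δ`, the part outside the chain, so the chain stays fixed
  -- in the induction.
  have ins : ∀ {Γ Δ : Set (Formula V)} {χ : Formula V}, Γ ⊆ Δ ∪ ⋃₀ c →
      insert χ Γ ⊆ insert χ Δ ∪ ⋃₀ c := by
    intro Γ Δ χ h
    rw [Set.insert_union]
    exact Set.insert_subset_insert h
  induction h with
  | ax h =>
    intro Δ hΔ
    rcases hΔ h with h | ⟨T, hT, h⟩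
    · obtain ⟨T, hT⟩ := hne
      exact ⟨T, hT, .ax (.inl h)⟩
    · exact ⟨T, hT, .ax (.inr h)⟩
  | botE _ ih => intro Δ hΔ; obtain ⟨T, hT, h⟩ := ih Δ hΔ; exact ⟨T, hT, .botE h⟩
  | andI _ _ ih₁ ih₂ =>
    intro Δ hΔ
    obtain ⟨T, hT, h₁⟩ := ih₁ Δ hΔ
    obtain ⟨U, hU, h₂⟩ := ih₂ Δ hΔ
    obtain ⟨W, hW, hTW, hUW⟩ := join hT hU
    exact ⟨W, hW, .andI (h₁.weaken (up hTW)) (h₂.weaken (up hUW))⟩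
  | andE₁ _ ih => intro Δ hΔ; obtain ⟨T, hT, h⟩ := ih Δ hΔ; exact ⟨T, hT, .andE₁ h⟩
  | andE₂ _ ih => intro Δ hΔ; obtain ⟨T, hT, h⟩ := ih Δ hΔ; exact ⟨T, hT, .andE₂ h⟩
  | orI₁ _ ih => intro Δ hΔ; obtain ⟨T, hT, h⟩ := ih Δ hΔ; exact ⟨T, hT, .orI₁ h⟩
  | orI₂ _ ih => intro Δ hΔ; obtain ⟨T, hT, h⟩ := ih Δ hΔ; exact ⟨T, hT, .orI₂ h⟩
  | orE _ _ _ ih ih₁ ih₂ =>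
    intro Δ hΔ
    obtain ⟨T, hT, h⟩ := ih Δ hΔ
    obtain ⟨T₁, hT₁, h₁⟩ := ih₁ _ (ins hΔ)
    obtain ⟨T₂, hT₂, h₂⟩ := ih₂ _ (ins hΔ)
    obtain ⟨U, hU, hTU, h₁U⟩ := join hT hT₁
    obtain ⟨W, hW, hUW, h₂W⟩ := join hU hT₂
    rw [Set.insert_union] at h₁ h₂
    exact ⟨W, hW, .orE (h.weaken (up (hTU.trans hUW)))
      (h₁.weaken (Set.insert_subset_insert (up (h₁U.trans hUW))))
      (h₂.weaken (Set.insert_subset_insert (up h₂W)))⟩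
  | impI _ ih =>
    intro Δ hΔ
    obtain ⟨T, hT, h⟩ := ih _ (ins hΔ)
    rw [Set.insert_union] at h
    exact ⟨T, hT, .impI h⟩
  | impE _ _ ih₁ ih₂ =>
    intro Δ hΔ
    obtain ⟨T, hT, h₁⟩ := ih₁ Δ hΔ
    obtain ⟨U, hU, h₂⟩ := ih₂ Δ hΔ
    obtain ⟨W, hW, hTW, hUW⟩ := join hT hU
    exact ⟨W, hW, .impE (h₁.weaken (up hTW)) (h₂.weaken (up hUW))⟩

end Derives

/-! ### Kripke semantics and soundness -/

/-- Forcing in the Kripke model on the preorder `W` with valuation `v`. -/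
def Forces {W : Type*} [Preorder W] (v : W → V → Prop) : W → Formula V → Prop
  | w, .var p => v w p
  | _, .bot => False
  | w, .and φ ψ => Forces v w φ ∧ Forces v w ψ
  | w, .or φ ψ => Forces v w φ ∨ Forces v w ψ
  | w, .imp φ ψ => ∀ u, w ≤ u → Forces v u φ → Forces v u ψ

section Kripke

variable {W : Type*} [Preorder W] {v : W → V → Prop}

theorem Forces.mono (hv : ∀ w u p, w ≤ u → v w p → v u p) {φ : Formula V} {w u : W}
    (hwu : w ≤ u) (h : Forces v w φ) : Forces v u φ := by
  induction φ with
  | var p => exact hv _ _ _ hwu h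
  | bot => exact h
  | and φ ψ ih₁ ih₂ => exact ⟨ih₁ h.1, ih₂ h.2⟩
  | or φ ψ ih₁ ih₂ => exact h.imp ih₁ ih₂
  | imp φ ψ _ _ => exact fun x hx => h x (hwu.trans hx)

theorem Derives.sound (hv : ∀ w u p, w ≤ u → v w p → v u p) {Γ : Set (Formula V)}
    {φ : Formula V} (h : Derives Γ φ) (w : W) (hw : ∀ ψ ∈ Γ, Forces v w ψ) : Forces v w φ := by
  induction h generalizing w with
  | ax h => exact hw _ h
  | botE _ ih => exact (ih w hw).elim
  | andI _ _ ih₁ ih₂ => exact ⟨ih₁ w hw, ih₂ w hw⟩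
  | andE₁ _ ih => exact (ih w hw).1
  | andE₂ _ ih => exact (ih w hw).2
  | orI₁ _ ih => exact .inl (ih w hw)
  | orI₂ _ ih => exact .inr (ih w hw)
  | orE _ _ _ ih ih₁ ih₂ =>
    rcases ih w hw with h | h
    · exact ih₁ w (Set.forall_mem_insert.2 ⟨h, hw⟩)
    · exact ih₂ w (Set.forall_mem_insert.2 ⟨h, hw⟩)
  | impI _ ih =>
    exact fun u hu h => ih u (Set.forall_mem_insert.2 ⟨h, fun ψ hψ => (hw ψ hψ).mono hv hu⟩)
  | impE _ _ ih₁ ih₂ => exact ih₁ w hw w le_rfl (ih₂ w hw)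

end Kripke

/-! ### The canonical model -/

/-- Consistent, deductively closed sets of formulas with the disjunction property: the worlds of
the canonical model. -/
structure PrimeTheory (V : Type*) where
  carrier : Set (Formula V)
  closed : ∀ {φ}, Derives carrier φ → φ ∈ carrier
  consistent : Formula.bot ∉ carrier
  prime : ∀ {φ ψ}, Formula.or φ ψ ∈ carrier → φ ∈ carrier ∨ ψ ∈ carrier

namespace PrimeTheory

instance : Preorder (PrimeTheory V) := Preorder.lift PrimeTheory.carrier

instance : Membership (Formula V) (PrimeTheory V) := ⟨fun T φ => φ ∈ T.carrier⟩

/-- By Zorn, take a maximal set not deriving `θ`; adding any further formula makes `θ` derivable,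
which forces closure and primeness. -/
theorem exists_extension {Γ : Set (Formula V)} {θ : Formula V} (h : ¬ Derives Γ θ) :
    ∃ T : PrimeTheory V, Γ ⊆ T.carrier ∧ θ ∉ T := by
  obtain ⟨T, hΓT, hT⟩ := zorn_subset_nonempty {Δ : Set (Formula V) | ¬ Derives Δ θ}
    (by
      intro c hc hchain hne
      refine ⟨⋃₀ c, fun hd => ?_, fun s hs => Set.subset_sUnion_of_mem hs⟩
      obtain ⟨T, hT, hTd⟩ := hd.of_sUnion_chain hchain hne ∅ (by simp)
      rw [Set.empty_union] at hTd
      exact hc hT hTd) Γ h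
  have hTθ : ¬ Derives T θ := hT.prop
  have hmax : ∀ χ, χ ∉ T → Derives (insert χ T) θ := fun χ hχ => by
    by_contra hn
    exact hχ (hT.le_of_ge (y := insert χ T) hn (Set.subset_insert _ _) (Set.mem_insert _ _))
  refine ⟨⟨T, ?_, ?_, ?_⟩, hΓT, fun hθ => hTθ (.ax hθ)⟩
  · intro χ hχ
    by_contra hn
    exact hTθ (hχ.cut (hmax χ hn))
  · exact fun hb => hTθ (.botE (.ax hb))
  · intro φ ψ hor
    by_contra! hn
    exact hTθ (.orE (.ax hor) (hmax φ hn.1) (hmax ψ hn.2))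

variable (T : PrimeTheory V)

theorem bot_not_mem : Formula.bot ∉ T := T.consistent

theorem and_mem {φ ψ : Formula V} : Formula.and φ ψ ∈ T ↔ φ ∈ T ∧ ψ ∈ T :=
  ⟨fun h => ⟨T.closed (.andE₁ (.ax h)), T.closed (.andE₂ (.ax h))⟩,
    fun h => T.closed (.andI (.ax h.1) (.ax h.2))⟩

theorem or_mem {φ ψ : Formula V} : Formula.or φ ψ ∈ T ↔ φ ∈ T ∨ ψ ∈ T :=
  ⟨fun h => T.prime h,
    fun h => h.elim (fun h => T.closed (.orI₁ (.ax h))) (fun h => T.closed (.orI₂ (.ax h)))⟩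

theorem imp_mem {φ ψ : Formula V} : Formula.imp φ ψ ∈ T ↔ ∀ U, T ≤ U → φ ∈ U → ψ ∈ U := by
  refine ⟨fun h U hU hφ => U.closed (.impE (.ax (hU h)) (.ax hφ)), fun h => ?_⟩
  by_contra hn
  have hd : ¬ Derives (insert φ T.carrier) ψ := fun hd => hn (T.closed (.impI hd))
  obtain ⟨U, hU, hψ⟩ := exists_extension hd
  exact hψ (h U ((Set.subset_insert _ _).trans hU) (hU (Set.mem_insert _ _)))

end PrimeTheory

theorem entails_iff {φ ψ : Formula V} : Entails φ ψ ↔ ∀ T : PrimeTheory V, φ ∈ T → ψ ∈ T := by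
  refine ⟨fun h T hT => T.closed (h.weaken (Set.singleton_subset_iff.2 hT)), fun h => ?_⟩
  by_contra hn
  obtain ⟨T, hT, hψ⟩ := PrimeTheory.exists_extension hn
  exact hψ (h T (hT rfl))

/-! ### Finite conjunctions and disjunctions, variables, subformulas -/

namespace Formula

def conj (l : List (Formula V)) : Formula V := l.foldr .and (.imp .bot .bot)

def disj (l : List (Formula V)) : Formula V := l.foldr .or .bot

theorem conj_mem (T : PrimeTheory V) (l : List (Formula V)) : conj l ∈ T ↔ ∀ χ ∈ l, χ ∈ T := by
  induction l with
  | nil => simpa [conj] using T.imp_mem.2 fun _ _ h => h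
  | cons a l ih => simpa [conj, T.and_mem] using fun _ => ih

theorem disj_mem (T : PrimeTheory V) (l : List (Formula V)) : disj l ∈ T ↔ ∃ χ ∈ l, χ ∈ T := by
  induction l with
  | nil => simpa [disj] using T.bot_not_mem
  | cons a l ih => simpa [disj, T.or_mem] using or_congr Iff.rfl ih

theorem vars_conj {l : List (Formula V)} {Q : Set V} (h : ∀ χ ∈ l, χ.vars ⊆ Q) :
    (conj l).vars ⊆ Q := by
  induction l with
  | nil => simp [conj, vars]
  | cons a l ih =>
    rw [List.forall_mem_cons] at h
    exact Set.union_subset h.1 (ih h.2)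

theorem vars_disj {l : List (Formula V)} {Q : Set V} (h : ∀ χ ∈ l, χ.vars ⊆ Q) :
    (disj l).vars ⊆ Q := by
  induction l with
  | nil => simp [disj, vars]
  | cons a l ih =>
    rw [List.forall_mem_cons] at h
    exact Set.union_subset h.1 (ih h.2)

theorem vars_finite (φ : Formula V) : φ.vars.Finite := by
  induction φ with
  | var p => exact Set.finite_singleton p
  | bot => exact Set.finite_empty
  | and _ _ h₁ h₂ => exact h₁.union h₂
  | or _ _ h₁ h₂ => exact h₁.union h₂
  | imp _ _ h₁ h₂ => exact h₁.union h₂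

noncomputable def subformulas : Formula V → Finset (Formula V)
  | .var p => {.var p}
  | .bot => {.bot}
  | .and φ ψ => insert (.and φ ψ) (φ.subformulas ∪ ψ.subformulas)
  | .or φ ψ => insert (.or φ ψ) (φ.subformulas ∪ ψ.subformulas)
  | .imp φ ψ => insert (.imp φ ψ) (φ.subformulas ∪ ψ.subformulas)

theorem self_mem_subformulas (φ : Formula V) : φ ∈ φ.subformulas := by
  cases φ <;> simp [subformulas]

theorem subformulas_subset {φ ψ : Formula V} (h : ψ ∈ φ.subformulas) :
    ψ.subformulas ⊆ φ.subformulas := by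
  induction φ with
  | var p => simp only [subformulas, Finset.mem_singleton] at h; rw [h]
  | bot => simp only [subformulas, Finset.mem_singleton] at h; rw [h]
  | and _ _ ih₁ ih₂ | or _ _ ih₁ ih₂ | imp _ _ ih₁ ih₂ =>
    simp only [subformulas, Finset.mem_insert, Finset.mem_union] at h
    rcases h with rfl | h | h
    · rfl
    · exact (ih₁ h).trans (Finset.subset_union_left.trans (Finset.subset_insert _ _))
    · exact (ih₂ h).trans (Finset.subset_union_right.trans (Finset.subset_insert _ _))

theorem mem_vars_of_var_mem_subformulas {φ : Formula V} {p : V} (h : var p ∈ φ.subformulas) :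
    p ∈ φ.vars := by
  induction φ with
  | var q => simpa [subformulas, vars] using h
  | bot => simp [subformulas] at h
  | and _ _ ih₁ ih₂ | or _ _ ih₁ ih₂ | imp _ _ ih₁ ih₂ =>
    simp only [subformulas, Finset.mem_insert, Finset.mem_union, reduceCtorEq, false_or] at h
    exact h.imp ih₁ ih₂

end Formula

/-! ### Layers and bounded back-and-forth -/

/-- The formula saying that every `χ ∈ F` in `A` holds only if some `χ ∈ F` outside `A` does:
a prime theory omits it iff some extension contains exactly the members `A` of `F`. -/
noncomputable def typeRefuter (F A : Finset (Formula V)) : Formula V :=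
  .imp (.conj A.toList) (.disj (F \ A).toList)

/-- Finite sets of formulas over `Q` that are fine enough to characterise prime theories up to
`n` rounds of back-and-forth. -/
noncomputable def layer (Q : Finset V) : ℕ → Finset (Formula V)
  | 0 => Q.image .var
  | n + 1 => layer Q n ∪ (layer Q n).powerset.image (typeRefuter (layer Q n))

theorem layer_mono (Q : Finset V) : Monotone (layer Q) :=
  monotone_nat_of_le_succ fun _ => Finset.subset_union_left

theorem vars_layer {Q : Finset V} {n : ℕ} {χ : Formula V} (h : χ ∈ layer Q n) :
    χ.vars ⊆ (Q : Set V) := by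
  induction n generalizing χ with
  | zero =>
    obtain ⟨p, hp, rfl⟩ := Finset.mem_image.1 h
    simpa [Formula.vars] using hp
  | succ n ih =>
    rcases Finset.mem_union.1 h with h | h
    · exact ih h
    · obtain ⟨A, hA, rfl⟩ := Finset.mem_image.1 h
      rw [Finset.mem_powerset] at hA
      refine Set.union_subset (Formula.vars_conj fun χ hχ => ?_) (Formula.vars_disj fun χ hχ => ?_)
      · exact ih (hA (Finset.mem_toList.1 hχ))
      · exact ih (Finset.mem_sdiff.1 (Finset.mem_toList.1 hχ)).1

/-- Two prime theories contain the same members of `F`. -/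
def Agree (F : Finset (Formula V)) (T U : PrimeTheory V) : Prop := ∀ χ ∈ F, χ ∈ T ↔ χ ∈ U

namespace Agree

variable {F G : Finset (Formula V)} {T U : PrimeTheory V}

theorem refl (F : Finset (Formula V)) (T : PrimeTheory V) : Agree F T T := fun _ _ => Iff.rfl

theorem symm (h : Agree F T U) : Agree F U T := fun χ hχ => (h χ hχ).symm

theorem mono (h : Agree G T U) (hFG : F ⊆ G) : Agree F T U := fun χ hχ => h χ (hFG hχ)

end Agree

noncomputable def typeOf (F : Finset (Formula V)) (T : PrimeTheory V) : Finset (Formula V) :=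
  F.filter (· ∈ T)

theorem typeRefuter_mem {F : Finset (Formula V)} {T U : PrimeTheory V} :
    typeRefuter F (typeOf F U) ∈ T ↔ ∀ W, T ≤ W → ¬ Agree F U W := by
  unfold typeRefuter
  rw [T.imp_mem]
  refine forall₂_congr fun W _ => ?_
  simp only [Formula.conj_mem, Formula.disj_mem, Finset.mem_toList, typeOf, Finset.mem_filter,
    Finset.mem_sdiff, Agree]
  constructor
  · intro h hA
    obtain ⟨χ, ⟨hF, hχ⟩, hW⟩ := h fun χ hχ => (hA χ hχ.1).1 hχ.2
    exact hχ ⟨hF, (hA χ hF).2 hW⟩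
  · intro h hW
    by_contra! hn
    refine h fun χ hχ => Iff.intro (fun hU => hW χ ⟨hχ, hU⟩) fun hχW => ?_
    by_contra hU
    exact hn χ ⟨hχ, fun _ => hU⟩ hχW

theorem typeRefuter_mem_layer (Q : Finset V) (n : ℕ) (U : PrimeTheory V) :
    typeRefuter (layer Q n) (typeOf (layer Q n) U) ∈ layer Q (n + 1) :=
  Finset.mem_union_right _ <| Finset.mem_image_of_mem _ <|
    Finset.mem_powerset.2 (Finset.filter_subset _ _)

/-- If the members of `layer Q (n + 1)` in `T` all belong to `U`, then `T` extends to a theory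
agreeing with `U` on `layer Q n`. -/
theorem exists_agree_of_subset {Q : Finset V} {n : ℕ} {T U : PrimeTheory V}
    (h : ∀ χ ∈ layer Q (n + 1), χ ∈ T → χ ∈ U) : ∃ T', T ≤ T' ∧ Agree (layer Q n) U T' := by
  by_contra! hn
  -- Without such an extension `T` contains the refuter of the type of `U`, hence so does `U`; but
  -- `U` realises its own type.
  exact typeRefuter_mem.1 (h _ (typeRefuter_mem_layer Q n U) (typeRefuter_mem.2 hn)) U le_rfl
    (Agree.refl _ _)

/-- One back-and-forth move, at the cost of one layer. -/
theorem Agree.exists_extension {Q : Finset V} {n : ℕ} {T U U' : PrimeTheory V}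
    (h : Agree (layer Q (n + 1)) T U) (hU : U ≤ U') :
    ∃ T', T ≤ T' ∧ Agree (layer Q n) T' U' := by
  obtain ⟨T', hT, hA⟩ := exists_agree_of_subset (T := T) (U := U') (n := n) (Q := Q)
    fun χ hχ hT => hU ((h χ hχ).1 hT)
  exact ⟨T', hT, hA.symm⟩

/-! ### The amalgam -/

/-- The number of members of `X` missing from `T`. -/
noncomputable def deficit (X : Finset (Formula V)) (T : PrimeTheory V) : ℕ :=
  (X.filter (· ∉ T)).card

theorem deficit_le_card (X : Finset (Formula V)) (T : PrimeTheory V) : deficit X T ≤ X.card :=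
  Finset.card_filter_le _ _

theorem Agree.deficit_eq {X : Finset (Formula V)} {T U : PrimeTheory V} (h : Agree X T U) :
    deficit X T = deficit X U := by
  unfold deficit
  congr 1
  exact Finset.filter_congr fun χ hχ => not_congr (h χ hχ)

/-- Extensions only gain members of `X`, so a move that changes the trace on `X` lowers the deficit.
This is what bounds the number of rounds. -/
theorem agree_or_deficit_lt (X : Finset (Formula V)) {T U : PrimeTheory V} (hTU : T ≤ U) :
    Agree X T U ∨ deficit X U < deficit X T := by
  by_cases h : Agree X T U
  · exact .inl h
  · refine .inr (Finset.card_lt_card ?_)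
    unfold Agree at h
    push Not at h
    obtain ⟨χ, hχ, h⟩ := h
    have hU : χ ∈ U ∧ χ ∉ T := by
      rcases h with h | h
      · exact (h.2 (hTU h.1)).elim
      · exact h.symm
    refine ⟨fun ψ hψ => ?_, fun hs => ?_⟩
    · rw [Finset.mem_filter] at hψ ⊢
      exact ⟨hψ.1, fun h => hψ.2 (hTU h)⟩
    · exact (Finset.mem_filter.1 (hs (Finset.mem_filter.2 ⟨hχ, hU.2⟩))).2 hU.1

/-- Worlds of the amalgam: a theory `right` that controls the formulas in `X`, and a theory
`left` that controls the variables outside the eliminated ones. The base points witness that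
moves of `left` can still be answered by `right`. -/
structure AmalgamWorld (Q : Finset V) (X : Finset (Formula V)) where
  left : PrimeTheory V
  right : PrimeTheory V
  witness : ∃ k m, k ≤ left ∧ m ≤ right ∧ Agree X m right ∧
    Agree (layer Q (2 * deficit X right + 1)) m k ∧
    Agree (layer Q (2 * deficit X right)) left right

namespace AmalgamWorld

variable {Q : Finset V} {X : Finset (Formula V)} {S : Set V}

/-- Right components are compared on `X` only: the answer to a left move extends the base point `m`,
not necessarily `w.right`. -/
instance : Preorder (AmalgamWorld Q X) where
  le w u := w.left ≤ u.left ∧ ∀ χ ∈ X, χ ∈ w.right → χ ∈ u.right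
  le_refl w := ⟨le_rfl, fun _ _ h => h⟩
  le_trans a b c hab hbc := ⟨hab.1.trans hbc.1, fun χ hχ h => hbc.2 χ hχ (hab.2 χ hχ h)⟩

def ofAgree (k m : PrimeTheory V) (h : Agree (layer Q (2 * deficit X m + 1)) k m) :
    AmalgamWorld Q X :=
  ⟨k, m, k, m, le_rfl, le_rfl, Agree.refl _ _, h.symm, h.mono (layer_mono Q (Nat.le_succ _))⟩

/-- The valuation of the amalgam, where `S` is the set of eliminated variables. -/
def val (S : Set V) (w : AmalgamWorld Q X) (p : V) : Prop :=
  if p ∈ S then Formula.var p ∈ X ∧ Formula.var p ∈ w.right else Formula.var p ∈ w.left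

/-- For `p ∈ S` this relies on the conjunct `Formula.var p ∈ X` in `val`, as the order ignores right
components outside `X`. -/
theorem val_mono (w u : AmalgamWorld Q X) (p : V) (hwu : w ≤ u) (h : val S w p) : val S u p := by
  unfold val at h ⊢
  split_ifs at h ⊢ with hp
  · exact ⟨h.1, hwu.2 _ h.1 h.2⟩
  · exact hwu.1 h

/-- The move is answered from the base points. If the answer keeps the trace on `X`, the same base
points serve again, so repeated left moves use up no layers; otherwise the deficit drops and pays
for new base points. -/
theorem exists_left_eq (w : AmalgamWorld Q X) {l : PrimeTheory V} (hl : w.left ≤ l) :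
    ∃ u, w ≤ u ∧ u.left = l := by
  obtain ⟨k, m, hk, hm, hmX, hkm, -⟩ := w.witness
  obtain ⟨m', hmm', hA⟩ := hkm.exists_extension (hk.trans hl)
  have hX : ∀ χ ∈ X, χ ∈ w.right → χ ∈ m' := fun χ hχ h => hmm' ((hmX χ hχ).2 h)
  rcases agree_or_deficit_lt X hmm' with h | h
  · have hd : deficit X m' = deficit X w.right := h.deficit_eq.symm.trans hmX.deficit_eq
    exact ⟨⟨l, m', k, m, hk.trans hl, hmm', h, by rwa [hd], by rw [hd]; exact hA.symm⟩,
      ⟨hl, hX⟩, rfl⟩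
  · rw [hmX.deficit_eq] at h
    -- The new deficit `d'` is below the old `d`, so `2 * d' + 1 ≤ 2 * d`.
    exact ⟨ofAgree l m' (hA.symm.mono (layer_mono Q (by omega))), ⟨hl, hX⟩, rfl⟩

theorem forces_iff_mem_left {θ : Formula V} (hθ : FreeOf S θ) (w : AmalgamWorld Q X) :
    Forces (val S) w θ ↔ θ ∈ w.left := by
  induction θ generalizing w with
  | var p => simp [Forces, val, hθ p rfl]
  | bot => simpa [Forces] using w.left.bot_not_mem
  | and φ ψ ih₁ ih₂ =>
    rw [PrimeTheory.and_mem, ← ih₁ (fun p hp => hθ p (.inl hp)),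
      ← ih₂ (fun p hp => hθ p (.inr hp))]
    rfl
  | or φ ψ ih₁ ih₂ =>
    rw [PrimeTheory.or_mem, ← ih₁ (fun p hp => hθ p (.inl hp)),
      ← ih₂ (fun p hp => hθ p (.inr hp))]
    rfl
  | imp φ ψ ih₁ ih₂ =>
    have h₁ := ih₁ fun p hp => hθ p (.inl hp)
    have h₂ := ih₂ fun p hp => hθ p (.inr hp)
    rw [PrimeTheory.imp_mem]
    constructor
    · intro h l hl hφ
      obtain ⟨u, hu, rfl⟩ := w.exists_left_eq hl
      exact (h₂ u).1 (h u hu ((h₁ u).2 hφ))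
    · exact fun h u hu hφ => (h₂ u).2 (h _ hu.1 ((h₁ u).1 hφ))

theorem forces_iff_mem_right (hX : ∀ χ ∈ X, χ.subformulas ⊆ X)
    (hQ : ∀ p, Formula.var p ∈ X → p ∉ S → p ∈ Q) {χ : Formula V} (hχ : χ ∈ X)
    (w : AmalgamWorld Q X) : Forces (val S) w χ ↔ χ ∈ w.right := by
  induction χ generalizing w with
  | var p =>
    by_cases hp : p ∈ S
    · simp [Forces, val, hp, hχ]
    · obtain ⟨-, -, -, -, -, -, hA⟩ := w.witness
      have := hA (.var p) (layer_mono Q (Nat.zero_le _) (Finset.mem_image_of_mem _ (hQ p hχ hp)))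
      simpa [Forces, val, hp] using this
  | bot => simpa [Forces] using w.right.bot_not_mem
  | and φ ψ ih₁ ih₂ =>
    have hφ : φ ∈ X := hX _ hχ (by simp [Formula.subformulas, φ.self_mem_subformulas])
    have hψ : ψ ∈ X := hX _ hχ (by simp [Formula.subformulas, ψ.self_mem_subformulas])
    rw [PrimeTheory.and_mem, ← ih₁ hφ, ← ih₂ hψ]
    rfl
  | or φ ψ ih₁ ih₂ =>
    have hφ : φ ∈ X := hX _ hχ (by simp [Formula.subformulas, φ.self_mem_subformulas])
    have hψ : ψ ∈ X := hX _ hχ (by simp [Formula.subformulas, ψ.self_mem_subformulas])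
    rw [PrimeTheory.or_mem, ← ih₁ hφ, ← ih₂ hψ]
    rfl
  | imp φ ψ ih₁ ih₂ =>
    have hφ : φ ∈ X := hX _ hχ (by simp [Formula.subformulas, φ.self_mem_subformulas])
    have hψ : ψ ∈ X := hX _ hχ (by simp [Formula.subformulas, ψ.self_mem_subformulas])
    constructor
    · intro h
      rw [PrimeTheory.imp_mem]
      intro m hm hφm
      rcases agree_or_deficit_lt X hm with hA | hlt
      -- `m` has the same trace on `X` as `w.right`, so `w` itself stands in for it.
      · exact (hA ψ hψ).1 ((ih₂ hψ w).1 (h w le_rfl ((ih₁ hφ w).2 ((hA φ hφ).2 hφm))))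
      · obtain ⟨-, -, -, -, -, -, hA⟩ := w.witness
        -- The deficit drops to `d' < d`, so `d` is positive, and the level `2 * d - 1` left after
        -- one move is at least `2 * d' + 1`, as `ofAgree` requires.
        obtain ⟨l, hl, hlm⟩ := (hA.mono (layer_mono Q (show 2 * deficit X w.right - 1 + 1 ≤
          2 * deficit X w.right by omega))).exists_extension hm
        let u : AmalgamWorld Q X := ofAgree l m (hlm.mono (layer_mono Q (by omega)))
        exact (ih₂ hψ u).1 (h u ⟨hl, fun χ _ hχ => hm hχ⟩ ((ih₁ hφ u).2 hφm))
    · intro h u hu hf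
      exact (ih₂ hψ u).2 (u.right.imp_mem.1 (hu.2 _ hχ h) _ le_rfl ((ih₁ hφ u).1 hf))

end AmalgamWorld

/-! ### The interpolants -/

/-- The variables of `φ` that are not eliminated. -/
noncomputable def keptVars (S : Set V) (φ : Formula V) : Finset V :=
  φ.vars_finite.toFinset.filter (· ∉ S)

/-- The number of back-and-forth rounds that suffices for amalgamation over `φ`. -/
noncomputable def rounds (φ : Formula V) : ℕ := 2 * φ.subformulas.card + 1

/-- Theories that agree up to `rounds φ` over the kept variables have a common amalgam. -/
theorem exists_amalgam {S : Set V} {φ : Formula V} {k m : PrimeTheory V}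
    (h : Agree (layer (keptVars S φ) (rounds φ)) k m) :
    ∃ w : AmalgamWorld (keptVars S φ) φ.subformulas,
      (∀ θ, FreeOf S θ → (Forces (AmalgamWorld.val S) w θ ↔ θ ∈ k)) ∧
      (Forces (AmalgamWorld.val S) w φ ↔ φ ∈ m) := by
  have hd := deficit_le_card φ.subformulas m
  refine ⟨.ofAgree k m (h.mono (layer_mono _ (by unfold rounds; omega))),
    fun θ hθ => AmalgamWorld.forces_iff_mem_left hθ _,
    AmalgamWorld.forces_iff_mem_right (fun χ hχ => Formula.subformulas_subset hχ) ?_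
      φ.self_mem_subformulas _⟩
  intro p hp hpS
  simpa [keptVars, hpS] using Formula.mem_vars_of_var_mem_subformulas hp

theorem vars_subset_and_freeOf {S : Set V} {φ χ : Formula V}
    (h : χ.vars ⊆ (keptVars S φ : Set V)) : χ.vars ⊆ φ.vars ∧ FreeOf S χ := by
  have : ∀ p ∈ χ.vars, p ∈ φ.vars ∧ p ∉ S := fun p hp => by simpa [keptVars] using h hp
  exact ⟨fun p hp => (this p hp).1, fun p hp => (this p hp).2⟩

theorem exists_isRightUniformInterpolant (S : Set V) (φ : Formula V) :
    ∃ ε, IsRightUniformInterpolant S φ ε := by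
  set Q := keptVars S φ
  set n := rounds φ
  let l := ((layer Q (n + 1)).filter (Entails φ)).toList
  have hl : ∀ {χ}, χ ∈ l ↔ χ ∈ layer Q (n + 1) ∧ Entails φ χ := by simp [l]
  obtain ⟨hv, hf⟩ := vars_subset_and_freeOf
    (Formula.vars_conj (l := l) fun χ hχ => vars_layer (hl.1 hχ).1)
  refine ⟨.conj l, hv, hf, entails_iff.2 fun T hT => (Formula.conj_mem T l).2 fun χ hχ =>
    entails_iff.1 (hl.1 hχ).2 T hT, fun θ hθ hφθ => entails_iff.2 fun k hk => ?_⟩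
  rw [Formula.conj_mem] at hk
  obtain ⟨m, hm, hA⟩ : ∃ m : PrimeTheory V, φ ∈ m ∧ Agree (layer Q n) k m := by
    -- Otherwise the refuter of the type of `k` follows from `φ`, so it is a conjunct of the
    -- interpolant and lies in `k`, which is absurd.
    by_contra! hno
    have hr : typeRefuter (layer Q n) (typeOf (layer Q n) k) ∈ k :=
      hk _ (hl.2 ⟨typeRefuter_mem_layer Q n k, entails_iff.2 fun T hT =>
        typeRefuter_mem.2 fun U hU => hno U (hU hT)⟩)
    exact typeRefuter_mem.1 hr k le_rfl (Agree.refl _ _)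
  obtain ⟨w, hw, hwφ⟩ := exists_amalgam hA
  exact (hw θ hθ).1 (Derives.sound AmalgamWorld.val_mono hφθ w (by simpa using hwφ.2 hm))

theorem exists_isLeftUniformInterpolant (S : Set V) (φ : Formula V) :
    ∃ α, IsLeftUniformInterpolant S φ α := by
  set Q := keptVars S φ
  set n := rounds φ
  let c : Finset (Formula V) → Formula V := fun A => .conj A.toList
  let l := (((layer Q (n + 1)).powerset.image c).filter (Entails · φ)).toList
  have hl : ∀ {χ}, χ ∈ l ↔ (∃ A ⊆ layer Q (n + 1), c A = χ) ∧ Entails χ φ := by simp [l]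
  obtain ⟨hv, hf⟩ := vars_subset_and_freeOf (Formula.vars_disj (l := l) fun χ hχ => by
    obtain ⟨⟨A, hA, rfl⟩, -⟩ := hl.1 hχ
    exact Formula.vars_conj fun χ hχ => vars_layer (hA (Finset.mem_toList.1 hχ)))
  refine ⟨.disj l, hv, hf, entails_iff.2 fun T hT => ?_, fun ψ hψ hψφ => entails_iff.2
    fun k hk => ?_⟩
  · obtain ⟨χ, hχ, hT⟩ := (Formula.disj_mem T l).1 hT
    exact entails_iff.1 (hl.1 hχ).2 T hT
  by_contra hno
  rw [Formula.disj_mem] at hno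
  push Not at hno
  have hne : ¬ Entails (c (typeOf (layer Q (n + 1)) k)) φ := fun he =>
    hno _ (hl.2 ⟨⟨_, Finset.filter_subset _ _, rfl⟩, he⟩)
      ((Formula.conj_mem k _).2 fun χ hχ => (Finset.mem_filter.1 (Finset.mem_toList.1 hχ)).2)
  rw [entails_iff] at hne
  push Not at hne
  obtain ⟨m, hcm, hm⟩ := hne
  rw [Formula.conj_mem] at hcm
  -- Only inclusion of the trace of `k` in `m` is known, so `k` must be extended; `ψ` persists to
  -- `k'`.
  obtain ⟨k', hk', hA⟩ := exists_agree_of_subset (T := k) (U := m) (n := n) (Q := Q)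
    fun χ hχ h => hcm χ (Finset.mem_toList.2 (Finset.mem_filter.2 ⟨hχ, h⟩))
  obtain ⟨w, hw, hwφ⟩ := exists_amalgam hA.symm
  exact hm (hwφ.1 (Derives.sound AmalgamWorld.val_mono hψφ w
    (by simpa using (hw ψ hψ).2 (hk' hk))))

end IPC

theorem theorem1 {V : Type*} (φ : IPC.Formula V) (S : Set V) :
    (∃ ε : IPC.Formula V, IPC.IsRightUniformInterpolant S φ ε) ∧
      (∃ α : IPC.Formula V, IPC.IsLeftUniformInterpolant S φ α) :=
  ⟨IPC.exists_isRightUniformInterpolant S φ, IPC.exists_isLeftUniformInterpolant S φ⟩
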